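/- Let $K$ be a compact hypergroup in the sense of Jewett: a compact Hausdorff space $K$ together with a bilinear, associative convolution $*$ on the space $M(K)$ of bounded regular complex Borel measures on $K$, weakly continuous in each variable (for the weak topology induced by the bounded continuous functions), such that (i) for $x,y\in K$, $\delta_x*\delta_y$ is a probability measure with compact support; (ii) $(x,y)\mapsto\operatorname{supp}(\delta_x*\delta_y)$ is continuous into the nonvoid compact subsets of $K$ with the Michael (Vietoris) topology; (iii) $(x,y)\mapsto\delta_x*\delta_y$ is continuous into $M(K)$ with the weak topology; (iv) there is $e\in K$ with $\delta_e*\delta_x=\delta_x*\delta_e=\delta_x$ for all $x\in K$; (v) there is a continuous involution $x\mapsto\check x$ of $K$ such that $(\delta_x*\delta_y)\check{}=\delta_{\check y}*\delta_{\check x}$ (where $\check\mu$ is the image of $\mu$ under the involution), and $e\in\operatorname{supp}(\delta_x*\delta_y)$ if and only if $x=\check y$. Let $\omega\in M(K)$ be a normalized Haar measure on $K$, that is, a regular Borel probability measure with $\delta_x*\omega=\omega$ for all $x\in K$. Let $\sigma\in M(K)$ be an adapted probability measure, that is, $$K=\overline{\bigcup_{n=1}^{\infty}\bigl(\operatorname{supp}\sigma\cup(\operatorname{supp}\sigma)\check{}\,\bigr)^n},$$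 where $A*B=\bigcup_{x\in A,\,y\in B}\operatorname{supp}(\delta_x*\delta_y)$ and $A^1=A$, $A^{n+1}=A^n*A$. Then the set $H_\sigma(K)=\{\mu\in M(K):\sigma*\mu=\mu\}$ of $\sigma$-harmonic measures is exactly $$H_\sigma(K)=\mathbb{C}\,\omega=\{c\,\omega: c\in\mathbb{C}\}.$$ -/

import Mathlib

open MeasureTheory Set Topology
open scoped BoundedContinuousFunction ENNReal NNReal

noncomputable section

namespace HypergroupTheory

section BoundedRegularMeasures

/-- A finite measure dominated by the sum of two finite regular measures is regular. -/
theorem regular_of_le_add {K : Type*} [TopologicalSpace K] [MeasurableSpace K] [BorelSpace K]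
    [T2Space K] {μ ν ρ : Measure K} [IsFiniteMeasure μ] [IsFiniteMeasure ν] [IsFiniteMeasure ρ]
    [μ.Regular] [ν.Regular] (h : ρ ≤ μ + ν) : ρ.Regular := by
  have key : ∀ A : Set K, MeasurableSet A → ∀ ε : ℝ≥0∞, ε ≠ 0 →
      ∃ C, C ⊆ A ∧ IsCompact C ∧ ρ (A \ C) < ε := by
    intro A hA ε hε
    have hε2 : ε / 2 ≠ 0 := by simpa using hε
    obtain ⟨C₁, hC₁, hc₁, h₁⟩ := hA.exists_isCompact_sdiff_lt (measure_ne_top μ A) hε2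
    obtain ⟨C₂, hC₂, hc₂, h₂⟩ := hA.exists_isCompact_sdiff_lt (measure_ne_top ν A) hε2
    refine ⟨C₁ ∪ C₂, union_subset hC₁ hC₂, hc₁.union hc₂, ?_⟩
    calc ρ (A \ (C₁ ∪ C₂)) ≤ (μ + ν) (A \ (C₁ ∪ C₂)) := h _
      _ = μ (A \ (C₁ ∪ C₂)) + ν (A \ (C₁ ∪ C₂)) := rfl
      _ ≤ μ (A \ C₁) + ν (A \ C₂) := by
        gcongr
        · exact subset_union_left
        · exact subset_union_right
      _ < ε / 2 + ε / 2 := ENNReal.add_lt_add h₁ h₂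
      _ = ε := ENNReal.add_halves ε
  have inner : ∀ A : Set K, MeasurableSet A → ∀ r < ρ A, ∃ C, C ⊆ A ∧ IsCompact C ∧ r < ρ C := by
    intro A hA r hr
    obtain ⟨C, hCA, hC, hlt⟩ := key A hA (ρ A - r) (tsub_pos_of_lt hr).ne'
    refine ⟨C, hCA, hC, ?_⟩
    by_contra hcon
    have h1 : ρ A ≤ ρ C + ρ (A \ C) := by
      calc ρ A ≤ ρ (C ∪ (A \ C)) := measure_mono (by simp)
        _ ≤ _ := measure_union_le _ _
    have h2 : ρ C + ρ (A \ C) < r + (ρ A - r) :=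
      ENNReal.add_lt_add_of_le_of_lt (measure_ne_top ρ C) (not_lt.1 hcon) hlt
    rw [add_tsub_cancel_of_le hr.le] at h2
    exact absurd h2 (not_lt.2 h1)
  have : ρ.InnerRegular := ⟨fun A hA r hr => by
    obtain ⟨C, h1, h2, h3⟩ := inner A hA r hr
    exact ⟨C, h1, h2, h3⟩⟩
  infer_instance

variable (K : Type*) [TopologicalSpace K] [MeasurableSpace K] [BorelSpace K] [T2Space K]

/-- The space `M(K)` of all bounded regular complex Borel measures on `K`: the complex measures
whose total variation measure is finite and regular. -/
def boundedRegularMeasures : Submodule ℂ (ComplexMeasure K) where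
  carrier := {μ | IsFiniteMeasure μ.variation ∧ μ.variation.Regular}
  zero_mem' := by
    simp only [mem_ofPred_eq, VectorMeasure.variation_zero]
    exact ⟨inferInstance, inferInstance⟩
  add_mem' := by
    rintro μ ν ⟨h1, h2⟩ ⟨h3, h4⟩
    have hle := VectorMeasure.variation_add_le (μ := μ) (ν := ν)
    have : IsFiniteMeasure (μ + ν).variation := isFiniteMeasure_of_le _ hle
    exact ⟨this, regular_of_le_add hle⟩
  smul_mem' := by
    rintro c μ ⟨h1, h2⟩
    simp only [mem_ofPred_eq, VectorMeasure.variation_smul]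
    exact ⟨inferInstance, inferInstance⟩

variable {K}

/-- The pairing `⟨μ, f⟩ = ∫ f dμ` of a bounded regular complex measure with a bounded
continuous function. -/
def pairing (μ : boundedRegularMeasures K) (f : K →ᵇ ℂ) : ℂ :=
  VectorMeasure.integral (μ : ComplexMeasure K) f (ContinuousLinearMap.mul ℝ ℂ)

/-- `M(K)` carries the weak topology: the coarsest one for which `μ ↦ ∫ f dμ` is continuous for
every bounded continuous `f`. -/
instance weakTopology : TopologicalSpace (boundedRegularMeasures K) :=
  .induced (fun μ (f : K →ᵇ ℂ) => pairing μ f) inferInstance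

/-- The support of `|μ|`. -/
def supp (μ : boundedRegularMeasures K) : Set K := (μ : ComplexMeasure K).variation.support

/-- `μ ∈ M(K)` is a (necessarily regular) probability measure. -/
def IsProbability (μ : boundedRegularMeasures K) : Prop :=
  ∃ P : Measure K, IsProbabilityMeasure P ∧
    ∀ A, MeasurableSet A → (μ : ComplexMeasure K) A = ((P.real A : ℝ) : ℂ)

/-- The point mass `δ_x`. -/
def delta (x : K) : boundedRegularMeasures K :=
  ⟨VectorMeasure.dirac x (1 : ℂ), by
    have : (Measure.dirac x).InnerRegular := ⟨fun A hA r hr => by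
      by_cases hx : x ∈ A
      · refine ⟨{x}, by simpa using hx, isCompact_singleton, ?_⟩
        simpa [Measure.dirac_apply' x hA, hx] using hr
      · simp [Measure.dirac_apply' x hA, hx] at hr⟩
    change IsFiniteMeasure _ ∧ Measure.Regular _
    simp only [VectorMeasure.variation_dirac, enorm_one, one_smul]
    exact ⟨inferInstance, inferInstance⟩⟩

end BoundedRegularMeasures

/-- A hypergroup structure on a locally compact Hausdorff space `K`. -/
structure Hypergroup (K : Type*) [TopologicalSpace K] [LocallyCompactSpace K] [T2Space K]
    [MeasurableSpace K] [BorelSpace K] where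
  /-- The bilinear convolution on `M(K)`. -/
  conv : boundedRegularMeasures K →ₗ[ℂ] boundedRegularMeasures K →ₗ[ℂ] boundedRegularMeasures K
  conv_assoc : ∀ μ ν ρ, conv (conv μ ν) ρ = conv μ (conv ν ρ)
  /-- Convolution is weakly continuous (in each variable). -/
  continuous_conv_left : ∀ μ, Continuous fun ν => conv μ ν
  continuous_conv_right : ∀ ν, Continuous fun μ => conv μ ν
  isProbability_conv_delta : ∀ x y, IsProbability (conv (delta x) (delta y))
  /-- The supports of `δ_x * δ_y` are nonvoid compact sets that depend continuously on `(x, y)`.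
  Mathlib's topology on `NonemptyCompacts K` is the Vietoris (Michael) topology. -/
  continuous_supp : ∃ S : K × K → TopologicalSpace.NonemptyCompacts K, Continuous S ∧
    ∀ x y, (S (x, y) : Set K) = supp (conv (delta x) (delta y))
  continuous_conv_delta : Continuous fun p : K × K => conv (delta p.1) (delta p.2)
  /-- The identity. -/
  e : K
  e_conv : ∀ x, conv (delta e) (delta x) = delta x
  conv_e : ∀ x, conv (delta x) (delta e) = delta x
  /-- The involution. -/
  inv : K → K
  continuous_inv : Continuous inv
  inv_inv : ∀ x, inv (inv x) = x
  map_inv_conv : ∀ x y,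
    VectorMeasure.map (conv (delta x) (delta y) : ComplexMeasure K) inv =
      (conv (delta (inv y)) (delta (inv x)) : ComplexMeasure K)
  e_mem_supp_iff : ∀ x y, e ∈ supp (conv (delta x) (delta y)) ↔ x = inv y

namespace Hypergroup

variable {K : Type*} [TopologicalSpace K] [LocallyCompactSpace K] [T2Space K]
  [MeasurableSpace K] [BorelSpace K] (H : Hypergroup K)

/-- The product of subsets, `A * B = ⋃_{x ∈ A, y ∈ B} supp (δ_x * δ_y)`. -/
def setMul (A B : Set K) : Set K :=
  ⋃ x ∈ A, ⋃ y ∈ B, supp (H.conv (delta x) (delta y))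

/-- `setPow A n` is the `(n + 1)`-fold product `A * ⋯ * A`. -/
def setPow (H : Hypergroup K) (A : Set K) : ℕ → Set K
  | 0 => A
  | n + 1 => H.setMul (H.setPow A n) A

/-- `μ` is adapted: the powers `(supp |μ| ∪ (supp |μ|)ˇ)ⁿ`, `n ≥ 1`, have dense union. -/
def IsAdapted (μ : boundedRegularMeasures K) : Prop :=
  closure (⋃ n : ℕ, H.setPow (supp μ ∪ H.inv '' supp μ) n) = univ

/-- The set `H_σ(K)` of all `σ`-harmonic measures `μ ∈ M(K)`. -/
def harmonicMeasures (σ : boundedRegularMeasures K) : Set (boundedRegularMeasures K) :=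
  {μ | H.conv σ μ = μ}

/-- `ω` is a normalized left Haar measure: a left invariant Radon probability measure. -/
def IsNormalizedHaar (ω : boundedRegularMeasures K) : Prop :=
  IsProbability ω ∧ ∀ x, H.conv (delta x) ω = ω

end Hypergroup

end HypergroupTheory

end

/-! Let `σ * μ = μ`. For continuous `f` the function `h x = ∫ f d(δ_x * μ)` is continuous, and
associativity gives `∫ h d(δ_x * σ) = h x`. The claim is that such an `h` is constant
(`eq_const_of_harmonic`); then `δ_x * μ = δ_e * μ = μ` for all `x`, and uniqueness of Haar measure
finishes.

Constancy is a variance argument (`eq_of_harmonic`). Let `ρ` be the image of `ω` under the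
involution, a right invariant probability measure with full support. The variance `∫ |h - h x|²
d(δ_x * σ)` equals `∫ |h|² d(δ_x * σ) - |h x|²`. It is nonnegative and continuous in `x`, and its
`ρ`-integral is zero because `ρ * σ = ρ`. So it vanishes identically, and `h` equals `h x` on `x *
supp σ`. Reversibility of supports (`mem_supp_of_mem_supp_inv`) extends this to the reflected
support, and adaptedness spreads it from `e` to all of `K`.

Uniqueness: for left invariant `μ`, evaluating `ρ * μ` by either invariance gives `μ = μ(K) ρ`; in
particular `ω = ρ`. -/

open scoped ComplexOrder

noncomputable section

namespace HypergroupTheory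

/-! ### Duality between `M(K)` and bounded continuous functions -/

section Pairing

variable {K : Type*} [TopologicalSpace K] [MeasurableSpace K] [BorelSpace K] [T2Space K]

instance isFiniteMeasure_variation (μ : boundedRegularMeasures K) :
    IsFiniteMeasure (μ : ComplexMeasure K).variation := μ.2.1

instance regular_variation (μ : boundedRegularMeasures K) :
    (μ : ComplexMeasure K).variation.Regular := μ.2.2

theorem integrable_boundedContinuous (μ : boundedRegularMeasures K) (f : K →ᵇ ℂ) :
    (μ : ComplexMeasure K).Integrable f :=
  f.integrable _

theorem enorm_complex_ofReal (r : ℝ) : ‖(r : ℂ)‖ₑ = ‖r‖ₑ := by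
  simp [enorm_eq_nnnorm]

theorem pairing_add_left (μ ν : boundedRegularMeasures K) (f : K →ᵇ ℂ) :
    pairing (μ + ν) f = pairing μ f + pairing ν f :=
  VectorMeasure.integral_add_vectorMeasure (integrable_boundedContinuous μ f)
    (integrable_boundedContinuous ν f)

theorem pairing_add_right (μ : boundedRegularMeasures K) (f g : K →ᵇ ℂ) :
    pairing μ (f + g) = pairing μ f + pairing μ g :=
  VectorMeasure.integral_add (integrable_boundedContinuous μ f)
    (integrable_boundedContinuous μ g)

theorem pairing_smul_right (μ : boundedRegularMeasures K) (c : ℂ) (f : K →ᵇ ℂ) :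
    pairing μ (c • f) = c * pairing μ f :=
  setToFun_smul (𝕜 := ℂ) _ (fun c s x => by
    simp [VectorMeasure.transpose, mul_left_comm]) c f

theorem pairing_smul_left (c : ℂ) (μ : boundedRegularMeasures K) (f : K →ᵇ ℂ) :
    pairing (c • μ) f = c * pairing μ f := by
  have hint := integrable_boundedContinuous μ f
  have hvar : (c • (μ : ComplexMeasure K)).variation ≤ ‖c‖ₑ • (μ : ComplexMeasure K).variation := by
    rw [VectorMeasure.variation_smul]
    rfl
  -- The integral against `c • μ` is built on the variation of `c • μ`; `hvar` allows it to be
  -- computed over the variation of `μ`, where `h1` applies.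
  have hT : DominatedFinMeasAdditive (μ : ComplexMeasure K).variation
      ((c • (μ : ComplexMeasure K)).transpose (ContinuousLinearMap.mul ℝ ℂ))
      (‖((ContinuousLinearMap.compL ℝ ℂ ℂ ℂ (ContinuousLinearMap.mul ℝ ℂ c)) ∘L
        ContinuousLinearMap.mul ℝ ℂ)‖) := by
    convert dominatedFinMeasAdditive_cbmApplyMeasure (μ : ComplexMeasure K)
      ((ContinuousLinearMap.compL ℝ ℂ ℂ ℂ (ContinuousLinearMap.mul ℝ ℂ c)) ∘L
        ContinuousLinearMap.mul ℝ ℂ) using 1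
    ext s x
    change x * (c * (μ : ComplexMeasure K) s) = c * (x * (μ : ComplexMeasure K) s)
    ring
  have h1 := VectorMeasure.continuousLinearMap_apply_integral (B := ContinuousLinearMap.mul ℝ ℂ)
    (C := ContinuousLinearMap.mul ℝ ℂ c) hint
  have h2 := setToFun_congr_measure_of_integrable ‖c‖ₑ enorm_ne_top hvar hT
    (dominatedFinMeasAdditive_cbmApplyMeasure (c • (μ : ComplexMeasure K)) _) f hint
  refine h2.symm.trans (Eq.trans ?_ h1.symm)
  rw [VectorMeasure.integral_eq_setToFun]
  refine setToFun_congr_left _ _ ?_ _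
  ext s x
  change x * (c * (μ : ComplexMeasure K) s) = c * (x * (μ : ComplexMeasure K) s)
  ring

/-- The pairing as a bilinear map. -/
def pairingₗ : (K →ᵇ ℂ) →ₗ[ℂ] boundedRegularMeasures K →ₗ[ℂ] ℂ :=
  LinearMap.mk₂ ℂ (fun f μ => pairing μ f) (fun f g μ => pairing_add_right μ f g)
    (fun c f μ => pairing_smul_right μ c f) (fun f μ ν => pairing_add_left μ ν f)
    (fun c f μ => pairing_smul_left c μ f)

theorem pairingₗ_apply (f : K →ᵇ ℂ) (μ : boundedRegularMeasures K) :
    pairingₗ f μ = pairing μ f := rfl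

theorem pairing_delta (x : K) (f : K →ᵇ ℂ) : pairing (delta x) f = f x := by
  simp [pairing, delta]

theorem continuous_pairing (f : K →ᵇ ℂ) :
    Continuous fun μ : boundedRegularMeasures K => pairing μ f :=
  (continuous_apply f).comp
    (continuous_induced_dom (f := fun μ (f : K →ᵇ ℂ) => pairing (K := K) μ f))

/-- A functional that is continuous for the topology induced by a family of functionals lies in
their span. -/
theorem mem_span_of_continuous_induced {ι E : Type*} [AddCommGroup E] [Module ℂ E]
    [t : TopologicalSpace E] (p : ι → E →ₗ[ℂ] ℂ)
    (ht : t = .induced (fun e i => p i e) inferInstance) (φ : E →ₗ[ℂ] ℂ) (hφ : Continuous φ) :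
    φ ∈ Submodule.span ℂ (range p) := by
  rw [LinearMap.mem_span_iff_continuous]
  convert hφ using 1
  rw [ht]
  exact (induced_to_pi (fun e i => p i e)).symm

/-- A weakly continuous functional on `M(K)` is the pairing with a bounded continuous function. -/
theorem exists_pairing_eq (φ : boundedRegularMeasures K →ₗ[ℂ] ℂ) (hφ : Continuous φ) :
    ∃ g : K →ᵇ ℂ, ∀ μ, φ μ = pairing μ g := by
  have h := mem_span_of_continuous_induced (E := boundedRegularMeasures K)
    (fun g : K →ᵇ ℂ => pairingₗ g) rfl φ hφ
  obtain ⟨g, hg⟩ := Submodule.span_le (p := LinearMap.range (pairingₗ (K := K))).2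
    (range_subset_iff.2 fun g => ⟨g, rfl⟩) h
  exact ⟨g, fun μ => by rw [← hg, pairingₗ_apply]⟩

/-- A bounded regular measure is determined by its pairings with bounded continuous functions. -/
theorem ext_pairing [CompactSpace K] {μ ν : boundedRegularMeasures K}
    (h : ∀ f, pairing μ f = pairing ν f) : μ = ν := by
  suffices H : ∀ ρ : boundedRegularMeasures K, (∀ f, pairing ρ f = 0) → ρ = 0 by
    rw [← sub_eq_zero]
    refine H _ fun f => ?_
    rw [← pairingₗ_apply, map_sub, pairingₗ_apply, pairingₗ_apply, h, sub_self]
  intro ρ hρ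
  set V := (ρ : ComplexMeasure K).variation
  have hcomp : ∀ C, IsCompact C → (ρ : ComplexMeasure K) C = 0 := by
    intro C hC
    have hCm := hC.measurableSet
    -- A Urysohn function between `C` and an open `U` of nearly the same variation differs from the
    -- indicator of `C` only on `U \ C`.
    have hlt : ∀ ε : ℝ≥0∞, ε ≠ 0 → ‖(ρ : ComplexMeasure K) C‖ₑ
        ≤ ‖ContinuousLinearMap.mul ℝ ℂ‖ₑ * ε := by
      intro ε hε
      obtain ⟨U, hCU, hU, -, hVU⟩ := hCm.exists_isOpen_sdiff_lt (measure_ne_top V C) hε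
      obtain ⟨g, hg0, hg1, hg⟩ := exists_continuous_zero_one_of_isClosed hU.isClosed_compl
        hC.isClosed (disjoint_compl_left_iff_subset.2 hCU)
      set f : K →ᵇ ℂ := .mkOfCompact ⟨fun x => (g x : ℂ), by fun_prop⟩ with hf
      have hi : Integrable (C.indicator fun _ => (1 : ℂ)) V :=
        (integrable_const (1 : ℂ)).indicator hCm
      have hsub := VectorMeasure.integral_sub (B := ContinuousLinearMap.mul ℝ ℂ) hi
        (integrable_boundedContinuous ρ f)
      rw [VectorMeasure.integral_indicator_const _ hCm, ← pairing, hρ, sub_zero] at hsub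
      rw [ContinuousLinearMap.mul_apply', one_mul] at hsub
      rw [← hsub]
      refine VectorMeasure.enorm_integral_le_lintegral_enorm.trans ?_
      gcongr
      calc ∫⁻ a, ‖(C.indicator (fun _ => (1 : ℂ)) - f) a‖ₑ ∂V
          ≤ ∫⁻ a, (U \ C).indicator 1 a ∂V := by
            refine lintegral_mono fun a => ?_
            by_cases haC : a ∈ C
            · have h1 : g a = 1 := hg1 haC
              simp [haC, hf, h1]
            · by_cases haU : a ∈ U
              · have h1 : ‖g a‖ₑ ≤ 1 := by
                  rw [Real.enorm_eq_ofReal (hg a).1]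
                  simpa using (hg a).2
                simpa [haC, haU, hf, enorm_complex_ofReal] using h1
              · have h1 : g a = 0 := hg0 haU
                simp [haC, haU, hf, h1]
        _ = V (U \ C) := lintegral_indicator_one (hU.measurableSet.diff hCm)
        _ ≤ ε := hVU.le
    have htend : Filter.Tendsto (fun ε : ℝ≥0∞ => ‖ContinuousLinearMap.mul ℝ ℂ‖ₑ * ε)
        (𝓝[≠] 0) (𝓝 0) := by
      have := (ENNReal.continuous_const_mul (a := ‖ContinuousLinearMap.mul ℝ ℂ‖ₑ)
        enorm_ne_top).tendsto 0
      rw [mul_zero] at this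
      exact this.mono_left nhdsWithin_le_nhds
    rw [← enorm_eq_zero, ← nonpos_iff_eq_zero]
    refine ge_of_tendsto htend ?_
    filter_upwards [self_mem_nhdsWithin] with ε hε using hlt ε hε
  have hA' : ∀ A, MeasurableSet A → (ρ : ComplexMeasure K) A = 0 := by
    intro A hA
    rw [← enorm_eq_zero, ← nonpos_iff_eq_zero]
    refine le_of_forall_pos_le_add fun ε hε => ?_
    obtain ⟨C, hCA, hC, hlt⟩ := hA.exists_isCompact_sdiff_lt (measure_ne_top V A) hε.ne'
    rw [← VectorMeasure.of_add_of_sdiff hC.measurableSet hA hCA, hcomp C hC, zero_add, zero_add]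
    exact (VectorMeasure.enorm_measure_le_variation _ _).trans hlt.le
  ext A hA
  simpa using hA' A hA

end Pairing

/-! ### Probability measures and supports -/

section Probability

variable {K : Type*} [TopologicalSpace K] [MeasurableSpace K] [BorelSpace K] [T2Space K]

theorem variation_eq_of_real {K : Type*} [MeasurableSpace K] {μ : ComplexMeasure K} {P : Measure K} [IsFiniteMeasure P]
    (h : ∀ A, MeasurableSet A → μ A = ((P.real A : ℝ) : ℂ)) : μ.variation = P := by
  apply le_antisymm
  · refine VectorMeasure.variation_le_of_forall_enorm_le fun s hs => ?_
    simp [h s hs, Measure.real, enorm_complex_ofReal, Real.enorm_eq_ofReal]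
  · refine Measure.le_iff.2 fun s hs => ?_
    refine le_trans ?_ (VectorMeasure.enorm_measure_le_variation _ _)
    simp [h s hs, Measure.real, enorm_complex_ofReal, Real.enorm_eq_ofReal]

theorem IsProbability.isProbabilityMeasure {μ : boundedRegularMeasures K} (hμ : IsProbability μ) :
    IsProbabilityMeasure (μ : ComplexMeasure K).variation := by
  obtain ⟨P, hP, h⟩ := hμ
  rwa [variation_eq_of_real h]

theorem IsProbability.pairing_eq {μ : boundedRegularMeasures K} (hμ : IsProbability μ)
    (f : K →ᵇ ℂ) : pairing μ f = ∫ x, f x ∂(μ : ComplexMeasure K).variation := by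
  obtain ⟨P, hP, h⟩ := hμ
  rw [pairing, VectorMeasure.integral_eq_setToFun, MeasureTheory.integral_eq_setToFun]
  refine setToFun_congr_left' _ _ (fun s hs h's => ?_) _
  ext
  simp [VectorMeasure.transpose, weightedSMul, h s hs, variation_eq_of_real h]

theorem IsProbability.pairing_one {μ : boundedRegularMeasures K} (hμ : IsProbability μ) :
    pairing μ 1 = 1 := by
  have := hμ.isProbabilityMeasure
  simp [hμ.pairing_eq]

theorem IsProbability.pairing_star {μ : boundedRegularMeasures K} (hμ : IsProbability μ)
    (f : K →ᵇ ℂ) : pairing μ (star f) = star (pairing μ f) := by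
  rw [hμ.pairing_eq, hμ.pairing_eq]
  exact integral_conj

theorem IsProbability.pairing_nonneg {μ : boundedRegularMeasures K} (hμ : IsProbability μ)
    {f : K →ᵇ ℂ} (hf : ∀ x, 0 ≤ f x) : 0 ≤ pairing μ f := by
  rw [hμ.pairing_eq]
  exact integral_nonneg hf

theorem IsProbability.eq_zero_of_pairing_eq_zero {μ : boundedRegularMeasures K}
    (hμ : IsProbability μ) {f : K →ᵇ ℂ} (hf : ∀ x, 0 ≤ f x) (h0 : pairing μ f = 0) {x : K}
    (hx : x ∈ supp μ) : f x = 0 := by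
  rw [hμ.pairing_eq] at h0
  have hre : ∀ y, (((f y).re : ℝ) : ℂ) = f y := fun y =>
    Complex.ext rfl (by simpa using (Complex.nonneg_iff.1 (hf y)).2)
  have h1 : ∫ y, (f y).re ∂(μ : ComplexMeasure K).variation = 0 := by
    rw [← Complex.ofReal_eq_zero, ← integral_complex_ofReal, ← h0]
    exact integral_congr_ae (.of_forall hre)
  have hae := (integral_eq_zero_iff_of_nonneg (fun y => (Complex.nonneg_iff.1 (hf y)).1)
    (f.integrable _).re).1 h1
  replace hae : ∀ᵐ y ∂(μ : ComplexMeasure K).variation, f y = 0 := by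
    filter_upwards [hae] with y hy
    rw [← hre y, show (f y).re = 0 from hy, Complex.ofReal_zero]
  by_contra hne
  exact ((Measure.mem_support_iff_forall x).1 hx _
    ((isOpen_ne.preimage f.continuous).mem_nhds hne)).ne' hae

theorem pairing_eq_zero_of_supp {μ : boundedRegularMeasures K} {f : K →ᵇ ℂ}
    (hf : ∀ x ∈ supp μ, f x = 0) : pairing μ f = 0 := by
  refine VectorMeasure.integral_eq_zero_of_ae ?_
  filter_upwards [Measure.support_mem_ae_of_regular (μ := (μ : ComplexMeasure K).variation)]
    with x hx using hf x hx

/-- On a compact space, points off a closed set are separated from it by a nonnegative function. -/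
theorem exists_separating {K : Type*} [TopologicalSpace K] [T2Space K] [CompactSpace K] {C : Set K} (hC : IsClosed C) {z : K} (hz : z ∉ C) :
    ∃ f : K →ᵇ ℂ, (∀ x, 0 ≤ f x) ∧ (∀ x ∈ C, f x = 0) ∧ f z ≠ 0 := by
  obtain ⟨g, hg0, hg1, hg⟩ := exists_continuous_zero_one_of_isClosed hC (isClosed_singleton (x := z))
    (by simpa using hz)
  refine ⟨.mkOfCompact ⟨fun x => (g x : ℂ), by fun_prop⟩, fun x => ?_, fun x hx => ?_, ?_⟩
  · simpa using (hg x).1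
  · simpa using hg0 hx
  · simp [hg1 (mem_singleton z)]

theorem isClosed_supp (μ : boundedRegularMeasures K) : IsClosed (supp μ) :=
  Measure.isClosed_support

/-- A point at which every nonnegative function with zero integral vanishes lies in the support. -/
theorem mem_supp_of_forall [CompactSpace K] {μ : boundedRegularMeasures K} {z : K}
    (h : ∀ f : K →ᵇ ℂ, (∀ x, 0 ≤ f x) → pairing μ f = 0 → f z = 0) : z ∈ supp μ := by
  by_contra hz
  obtain ⟨f, hf, hf0, hfz⟩ := exists_separating (isClosed_supp μ) hz
  exact hfz (h f hf (pairing_eq_zero_of_supp hf0))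

theorem IsProbability.supp_nonempty [CompactSpace K] {μ : boundedRegularMeasures K}
    (hμ : IsProbability μ) : (supp μ).Nonempty := by
  by_contra! h
  have := pairing_eq_zero_of_supp (μ := μ) (f := 1) fun x hx => by simp [h] at hx
  rw [hμ.pairing_one] at this
  exact one_ne_zero this

theorem isProbability_delta (x : K) : IsProbability (delta x) :=
  ⟨Measure.dirac x, inferInstance, fun A hA => by
    by_cases hx : x ∈ A <;> simp [delta, Measure.real, hA, hx]⟩

theorem supp_delta [CompactSpace K] (x : K) : supp (delta x) = {x} := by
  refine subset_antisymm (fun z hz => ?_) ?_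
  · by_contra hzx
    obtain ⟨f, hf, hf0, hfz⟩ := exists_separating (isClosed_singleton (x := x)) hzx
    exact hfz ((isProbability_delta x).eq_zero_of_pairing_eq_zero hf
      (by rw [pairing_delta]; exact hf0 x rfl) hz)
  · rintro _ rfl
    exact mem_supp_of_forall fun f _ h0 => by rwa [pairing_delta] at h0

end Probability

/-! ### Translates and invariant measures -/

namespace Hypergroup

variable {K : Type*} [TopologicalSpace K] [CompactSpace K] [T2Space K]
  [MeasurableSpace K] [BorelSpace K] (H : Hypergroup K)

/-- Weak continuity in the second variable makes this a weakly continuous functional of `ν`, so one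
function represents it for all `ν`, not only for point masses; no Fubini argument is needed. -/
theorem exists_leftTranslate (μ : boundedRegularMeasures K) (f : K →ᵇ ℂ) :
    ∃ g : K →ᵇ ℂ, ∀ ν, pairing (H.conv μ ν) f = pairing ν g :=
  exists_pairing_eq (pairingₗ f ∘ₗ H.conv μ)
    ((continuous_pairing f).comp (H.continuous_conv_left μ))

theorem exists_rightTranslate (ν : boundedRegularMeasures K) (f : K →ᵇ ℂ) :
    ∃ g : K →ᵇ ℂ, ∀ μ, pairing (H.conv μ ν) f = pairing μ g :=
  exists_pairing_eq (pairingₗ f ∘ₗ H.conv.flip ν)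
    ((continuous_pairing f).comp (H.continuous_conv_right ν))

/-- The function `y ↦ ∫ f d(μ * δ_y)`. -/
def leftTranslate (μ : boundedRegularMeasures K) (f : K →ᵇ ℂ) : K →ᵇ ℂ :=
  (H.exists_leftTranslate μ f).choose

/-- The function `x ↦ ∫ f d(δ_x * ν)`. -/
def rightTranslate (ν : boundedRegularMeasures K) (f : K →ᵇ ℂ) : K →ᵇ ℂ :=
  (H.exists_rightTranslate ν f).choose

theorem pairing_conv_left (μ ν : boundedRegularMeasures K) (f : K →ᵇ ℂ) :
    pairing (H.conv μ ν) f = pairing ν (H.leftTranslate μ f) :=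
  (H.exists_leftTranslate μ f).choose_spec ν

theorem pairing_conv_right (μ ν : boundedRegularMeasures K) (f : K →ᵇ ℂ) :
    pairing (H.conv μ ν) f = pairing μ (H.rightTranslate ν f) :=
  (H.exists_rightTranslate ν f).choose_spec μ

theorem leftTranslate_apply (μ : boundedRegularMeasures K) (f : K →ᵇ ℂ) (y : K) :
    H.leftTranslate μ f y = pairing (H.conv μ (delta y)) f := by
  rw [pairing_conv_left, pairing_delta]

theorem rightTranslate_apply (ν : boundedRegularMeasures K) (f : K →ᵇ ℂ) (x : K) :
    H.rightTranslate ν f x = pairing (H.conv (delta x) ν) f := by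
  rw [pairing_conv_right, pairing_delta]

theorem delta_e_conv (μ : boundedRegularMeasures K) : H.conv (delta H.e) μ = μ := by
  refine ext_pairing fun f => ?_
  rw [pairing_conv_left]
  congr 1
  ext y
  rw [leftTranslate_apply, e_conv, pairing_delta]

/-- A measure invariant under left translations absorbs every measure from the left. -/
theorem conv_eq_smul_of_left_invariant {μ : boundedRegularMeasures K}
    (hμ : ∀ x, H.conv (delta x) μ = μ) (ν : boundedRegularMeasures K) :
    H.conv ν μ = pairing ν 1 • μ := by
  refine ext_pairing fun f => ?_
  have h : H.rightTranslate μ f = pairing μ f • (1 : K →ᵇ ℂ) := by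
    ext x
    simp [rightTranslate_apply, hμ]
  rw [pairing_conv_right, h, pairing_smul_right, pairing_smul_left, mul_comm]

/-- A measure invariant under right translations absorbs every measure from the right. -/
theorem conv_eq_smul_of_right_invariant {μ : boundedRegularMeasures K}
    (hμ : ∀ x, H.conv μ (delta x) = μ) (ν : boundedRegularMeasures K) :
    H.conv μ ν = pairing ν 1 • μ := by
  refine ext_pairing fun f => ?_
  have h : H.leftTranslate μ f = pairing μ f • (1 : K →ᵇ ℂ) := by
    ext x
    simp [leftTranslate_apply, hμ]
  rw [pairing_conv_left, h, pairing_smul_right, pairing_smul_left, mul_comm]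

/-! ### The involution -/

/-- The image of a function under the involution. -/
def reflect (f : K →ᵇ ℂ) : K →ᵇ ℂ := f.compContinuous ⟨H.inv, H.continuous_inv⟩

theorem reflect_apply (f : K →ᵇ ℂ) (x : K) : H.reflect f x = f (H.inv x) := rfl

/-- The involution as a homeomorphism. -/
def invHomeomorph : K ≃ₜ K where
  toFun := H.inv
  invFun := H.inv
  left_inv := H.inv_inv
  right_inv := H.inv_inv
  continuous_toFun := H.continuous_inv
  continuous_invFun := H.continuous_inv

/-- The image of a measure under the involution. -/
def mapInv (μ : boundedRegularMeasures K) : boundedRegularMeasures K :=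
  ⟨VectorMeasure.map (μ : ComplexMeasure K) H.inv, by
    have h := H.invHomeomorph.measurableEmbedding.variation_map (μ := (μ : ComplexMeasure K))
    refine ⟨inferInstance, ?_⟩
    change Measure.Regular (VectorMeasure.map (μ : ComplexMeasure K) H.invHomeomorph).variation
    rw [h]
    exact Measure.Regular.map H.invHomeomorph⟩

theorem pairing_mapInv (μ : boundedRegularMeasures K) (f : K →ᵇ ℂ) :
    pairing (H.mapInv μ) f = pairing μ (H.reflect f) :=
  H.invHomeomorph.measurableEmbedding.integral_map_vectorMeasure

theorem isProbability_mapInv {μ : boundedRegularMeasures K} (hμ : IsProbability μ) :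
    IsProbability (H.mapInv μ) := by
  obtain ⟨P, hP, h⟩ := hμ
  have hm : Measurable H.inv := H.continuous_inv.measurable
  refine ⟨P.map H.inv, Measure.isProbabilityMeasure_map hm.aemeasurable, fun A hA => ?_⟩
  rw [map_measureReal_apply hm hA, ← h _ (hm hA)]
  exact VectorMeasure.map_apply _ hm hA

theorem mapInv_conv_delta (x y : K) :
    H.mapInv (H.conv (delta x) (delta y)) = H.conv (delta (H.inv y)) (delta (H.inv x)) :=
  Subtype.ext (H.map_inv_conv x y)

theorem pairing_reflect_conv_delta (x y : K) (f : K →ᵇ ℂ) :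
    pairing (H.conv (delta x) (delta y)) (H.reflect f) =
      pairing (H.conv (delta (H.inv y)) (delta (H.inv x))) f := by
  rw [← pairing_mapInv, mapInv_conv_delta]

/-- The involution reverses products, so it exchanges left and right translates and turns left
invariance into right invariance. -/
theorem mapInv_conv_delta_of_left_invariant {ω : boundedRegularMeasures K}
    (hω : ∀ x, H.conv (delta x) ω = ω) (x : K) :
    H.conv (H.mapInv ω) (delta x) = H.mapInv ω := by
  refine ext_pairing fun f => ?_
  have h : H.reflect (H.rightTranslate (delta x) f) =
      H.leftTranslate (delta (H.inv x)) (H.reflect f) := by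
    ext y
    rw [reflect_apply, rightTranslate_apply, leftTranslate_apply, pairing_reflect_conv_delta,
      H.inv_inv]
  rw [pairing_conv_right, pairing_mapInv, h, ← pairing_conv_left, hω, pairing_mapInv]

/-! ### Supports of products -/

theorem inv_mem_supp {x y s : K} (hs : s ∈ supp (H.conv (delta x) (delta y))) :
    H.inv s ∈ supp (H.conv (delta (H.inv y)) (delta (H.inv x))) := by
  refine mem_supp_of_forall fun f hf h0 => ?_
  rw [← pairing_reflect_conv_delta] at h0
  exact (H.isProbability_conv_delta x y).eq_zero_of_pairing_eq_zero
    (f := H.reflect f) (fun x => hf _) h0 hs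

/-- This is `supp μ * y ⊆ supp (μ * δ_y)` in terms of test functions, a form that can be chained
without knowing that triple products are positive. -/
theorem mem_supp_conv_delta {μ : boundedRegularMeasures K} (hμ : IsProbability μ) {s y z : K}
    (hs : s ∈ supp μ) (hz : z ∈ supp (H.conv (delta s) (delta y))) {f : K →ᵇ ℂ}
    (hf : ∀ x, 0 ≤ f x) (h0 : pairing (H.conv μ (delta y)) f = 0) : f z = 0 := by
  rw [pairing_conv_right] at h0
  have hpos : ∀ x, 0 ≤ H.rightTranslate (delta y) f x := fun x => by
    rw [rightTranslate_apply]
    exact (H.isProbability_conv_delta x y).pairing_nonneg hf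
  have h1 := hμ.eq_zero_of_pairing_eq_zero hpos h0 hs
  rw [rightTranslate_apply] at h1
  exact (H.isProbability_conv_delta s y).eq_zero_of_pairing_eq_zero hf h1 hz

/-- The product of a point and a closed set is closed. -/
theorem isClosed_iUnion_supp (x : K) {C : Set K} (hC : IsClosed C) :
    IsClosed (⋃ u ∈ C, supp (H.conv (delta x) (delta u))) := by
  obtain ⟨S, hS, hSs⟩ := H.continuous_supp
  rw [← isOpen_compl_iff, isOpen_iff_mem_nhds]
  intro z hz
  simp only [mem_compl_iff, mem_iUnion, exists_prop, not_exists, not_and] at hz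
  have key : ∃ U ∈ 𝓝 z, ∀ u ∈ C, Disjoint U (supp (H.conv (delta x) (delta u))) := by
    refine hC.isCompact.induction_on (p := fun D => ∃ U ∈ 𝓝 z, ∀ u ∈ D,
      Disjoint U (supp (H.conv (delta x) (delta u)))) ⟨univ, Filter.univ_mem, by simp⟩ ?_ ?_ ?_
    · rintro D E hDE ⟨U, hU, h⟩
      exact ⟨U, hU, fun u hu => h u (hDE hu)⟩
    · rintro D E ⟨U, hU, h⟩ ⟨V, hV, h'⟩
      refine ⟨U ∩ V, Filter.inter_mem hU hV, ?_⟩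
      rintro u (hu | hu)
      · exact (h u hu).mono_left inter_subset_left
      · exact (h' u hu).mono_left inter_subset_right
    · intro u hu
      obtain ⟨U, V, hU, hV, hzU, hsV, hUV⟩ := SeparatedNhds.of_isCompact_isCompact
        (isCompact_singleton (x := z)) (isClosed_supp (H.conv (delta x) (delta u))).isCompact
        (disjoint_singleton_left.2 (hz u hu))
      -- In the Vietoris topology, being contained in the open set `V` is an open condition, so it
      -- persists near `u`.
      refine ⟨{w | (S (x, w) : Set K) ⊆ V}, mem_nhdsWithin_of_mem_nhds (IsOpen.mem_nhds ?_ ?_),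
        U, hU.mem_nhds (hzU rfl), fun w hw => ?_⟩
      · exact (TopologicalSpace.NonemptyCompacts.isOpen_subsets_of_isOpen hV).preimage
          (hS.comp (Continuous.prodMk_right x))
      · simpa only [mem_ofPred_eq, hSs] using hsV
      · rw [← hSs]
        exact hUV.mono_right hw
  obtain ⟨U, hU, h⟩ := key
  filter_upwards [hU] with w hw hwC
  simp only [mem_iUnion, exists_prop] at hwC
  obtain ⟨u, hu, hwu⟩ := hwC
  exact disjoint_left.1 (h u hu) hw hwu

/-- The converse inclusion `supp (δ_x * μ) ⊆ x * supp μ`: since the right side is closed, a point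
off it can be separated by a test function. -/
theorem exists_mem_supp_of_forall {μ : boundedRegularMeasures K} {x z : K}
    (h : ∀ f : K →ᵇ ℂ, (∀ x, 0 ≤ f x) → pairing (H.conv (delta x) μ) f = 0 → f z = 0) :
    ∃ u ∈ supp μ, z ∈ supp (H.conv (delta x) (delta u)) := by
  by_contra! hz
  obtain ⟨f, hf, hf0, hfz⟩ := exists_separating (z := z)
    (H.isClosed_iUnion_supp x (isClosed_supp μ)) (by simpa using hz)
  refine hfz (h f hf ?_)
  rw [pairing_conv_left]
  refine pairing_eq_zero_of_supp fun u hu => ?_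
  rw [leftTranslate_apply]
  exact pairing_eq_zero_of_supp fun t ht => hf0 t (mem_biUnion hu ht)

/-- `t ∈ x * yˇ` implies `x ∈ t * y`. -/
theorem mem_supp_of_mem_supp_inv {x y t : K}
    (ht : t ∈ supp (H.conv (delta x) (delta (H.inv y)))) :
    x ∈ supp (H.conv (delta t) (delta y)) := by
  -- `e ∈ t * tˇ ⊆ x * (yˇ * tˇ)`, so `e ∈ x * u` with `u ∈ yˇ * tˇ`; hence `x = uˇ`, which lies in
  -- `t * y`.
  have he : H.e ∈ supp (H.conv (delta t) (delta (H.inv t))) :=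
    (H.e_mem_supp_iff _ _).2 (H.inv_inv t).symm
  obtain ⟨u, hu, heu⟩ := H.exists_mem_supp_of_forall (x := x) (z := H.e)
    (μ := H.conv (delta (H.inv y)) (delta (H.inv t))) fun f hf h0 => by
      rw [← conv_assoc] at h0
      exact H.mem_supp_conv_delta (H.isProbability_conv_delta _ _) ht he hf h0
  rw [e_mem_supp_iff] at heu
  have := H.inv_mem_supp hu
  rwa [H.inv_inv, H.inv_inv, ← heu] at this

/-- A right invariant probability measure has full support. -/
theorem supp_eq_univ_of_right_invariant {μ : boundedRegularMeasures K} (hμ : IsProbability μ)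
    (hinv : ∀ x, H.conv μ (delta x) = μ) : supp μ = univ := by
  have key : ∀ s ∈ supp μ, ∀ y z, z ∈ supp (H.conv (delta s) (delta y)) → z ∈ supp μ :=
    fun s hs y z hz => mem_supp_of_forall fun f hf h0 =>
      H.mem_supp_conv_delta hμ hs hz hf (by rwa [hinv])
  obtain ⟨s, hs⟩ := hμ.supp_nonempty
  have he : H.e ∈ supp μ :=
    key s hs (H.inv s) _ ((H.e_mem_supp_iff _ _).2 (H.inv_inv s).symm)
  refine eq_univ_of_forall fun z => key _ he z z ?_
  rw [e_conv, supp_delta]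
  rfl

/-! ### Continuous harmonic functions -/

/-- A continuous function that is harmonic with respect to right convolution by `σ` is constant
along right translations by points of the support of `σ`. -/
theorem eq_of_harmonic {ω σ : boundedRegularMeasures K} (hω : IsProbability ω)
    (hinv : ∀ x, H.conv ω (delta x) = ω) (hσ : IsProbability σ) {h : K →ᵇ ℂ}
    (hh : ∀ x, pairing (H.conv (delta x) σ) h = h x) {x y t : K} (hy : y ∈ supp σ)
    (ht : t ∈ supp (H.conv (delta x) (delta y))) : h t = h x := by
  set q : K →ᵇ ℂ := h * star h with hq
  set W : K → (K →ᵇ ℂ) := fun x => (h - h x • 1) * star (h - h x • 1) with hW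
  have hWapp : ∀ x s, W x s = (h s - h x) * star (h s - h x) := fun x s => by simp [hW]
  have hWpos : ∀ x s, 0 ≤ W x s := fun x s => by
    rw [hWapp]
    exact mul_star_self_nonneg _
  have hWexp : ∀ x, W x = q - star (h x) • h - h x • star h + (h x * star (h x)) • 1 := fun x => by
    ext s
    simp [hWapp, hq]
    ring
  -- `δ_x * σ` has not been shown to be a probability measure, so its mass and conjugation rule come
  -- from the measures `δ_x * δ_y`, integrated over `σ`.
  have hone : ∀ x, pairing (H.conv (delta x) σ) 1 = 1 := fun x => by
    have : H.leftTranslate (delta x) 1 = 1 := by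
      ext y
      simp [leftTranslate_apply, (H.isProbability_conv_delta x y).pairing_one]
    rw [pairing_conv_left, this, hσ.pairing_one]
  have hstar : ∀ x, pairing (H.conv (delta x) σ) (star h) = star (h x) := fun x => by
    have : H.leftTranslate (delta x) (star h) = star (H.leftTranslate (delta x) h) := by
      ext y
      simp [leftTranslate_apply, (H.isProbability_conv_delta x y).pairing_star]
    rw [pairing_conv_left, this, hσ.pairing_star, ← pairing_conv_left, hh]
  -- Variance as second moment minus squared mean; harmonicity says that the mean is `h x`.
  have hpair : ∀ x, pairing (H.conv (delta x) σ) (W x) = (H.rightTranslate σ q - q) x := fun x => by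
    have e1 := congrArg (fun f => pairingₗ f (H.conv (delta x) σ)) (hWexp x)
    simp only [map_add, map_sub, map_smul, LinearMap.add_apply, LinearMap.sub_apply,
      LinearMap.smul_apply, pairingₗ_apply, hone, hstar, hh, smul_eq_mul] at e1
    rw [e1]
    simp [rightTranslate_apply, hq]
    ring
  have hLpos : ∀ x y, 0 ≤ H.leftTranslate (delta x) (W x) y := fun x y => by
    rw [leftTranslate_apply]
    exact (H.isProbability_conv_delta x y).pairing_nonneg (hWpos x)
  have hVpos : ∀ x, 0 ≤ (H.rightTranslate σ q - q) x := fun x => by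
    rw [← hpair, pairing_conv_left]
    exact hσ.pairing_nonneg (hLpos x)
  have hV0 : pairing ω (H.rightTranslate σ q - q) = 0 := by
    rw [← pairingₗ_apply, map_sub, LinearMap.sub_apply, pairingₗ_apply, pairingₗ_apply,
      ← pairing_conv_right, H.conv_eq_smul_of_right_invariant hinv, hσ.pairing_one, one_smul,
      sub_self]
  have hVx := hω.eq_zero_of_pairing_eq_zero hVpos hV0 (x := x)
    (by rw [H.supp_eq_univ_of_right_invariant hω hinv]; trivial)
  -- The vanishing integral is localized twice: first at `y ∈ supp σ`, then at `t ∈ x * y`.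
  rw [← hpair, pairing_conv_left] at hVx
  have h1 := hσ.eq_zero_of_pairing_eq_zero (hLpos x) hVx hy
  rw [leftTranslate_apply] at h1
  have h2 := (H.isProbability_conv_delta x y).eq_zero_of_pairing_eq_zero (hWpos x) h1 ht
  rw [hWapp, CStarRing.mul_star_self_eq_zero_iff] at h2
  exact sub_eq_zero.1 h2

/-- If `σ` is adapted, then continuous harmonic functions are constant. -/
theorem eq_const_of_harmonic {ω σ : boundedRegularMeasures K} (hω : IsProbability ω)
    (hinv : ∀ x, H.conv ω (delta x) = ω) (hσ : IsProbability σ) (hσa : H.IsAdapted σ)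
    {h : K →ᵇ ℂ} (hh : ∀ x, pairing (H.conv (delta x) σ) h = h x) (x : K) : h x = h H.e := by
  have step : ∀ x, ∀ y ∈ supp σ ∪ H.inv '' supp σ, ∀ t ∈ supp (H.conv (delta x) (delta y)),
      h t = h x := by
    rintro x y (hy | ⟨y, hy, rfl⟩) t ht
    · exact H.eq_of_harmonic hω hinv hσ hh hy ht
    -- Here `t ∈ x * yˇ`, so `x ∈ t * y` and the first case applies with `x` and `t` exchanged.
    · exact (H.eq_of_harmonic hω hinv hσ hh hy (H.mem_supp_of_mem_supp_inv ht)).symm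
  have hpow : ∀ n, ∀ s ∈ H.setPow (supp σ ∪ H.inv '' supp σ) n, h s = h H.e := by
    intro n
    induction n with
    | zero =>
      intro s hs
      -- Index `0` is the generating set itself, reached from `e` because `s ∈ e * s`.
      refine step H.e s hs s ?_
      rw [e_conv, supp_delta]
      rfl
    | succ n ih =>
      intro s hs
      simp only [setPow, setMul, mem_iUnion] at hs
      obtain ⟨r, hr, a, ha, hs⟩ := hs
      rw [step r a ha s hs, ih r hr]
  have hcl : closure (⋃ n, H.setPow (supp σ ∪ H.inv '' supp σ) n) ⊆ {s | h s = h H.e} := by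
    refine closure_minimal (iUnion_subset hpow) ?_
    exact isClosed_eq h.continuous continuous_const
  rw [hσa] at hcl
  exact hcl (mem_univ x)

end Hypergroup

end HypergroupTheory

end

/-! ### Harmonic measures are multiples of Haar measure -/

open HypergroupTheory in
theorem mainTheorem8 {K : Type*} [TopologicalSpace K] [CompactSpace K] [T2Space K]
    [MeasurableSpace K] [BorelSpace K] (H : HypergroupTheory.Hypergroup K)
    (ω : HypergroupTheory.boundedRegularMeasures K) (hω : H.IsNormalizedHaar ω)
    (σ : HypergroupTheory.boundedRegularMeasures K)
    (hσ : HypergroupTheory.IsProbability σ) (hσa : H.IsAdapted σ) :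
    H.harmonicMeasures σ = Set.range fun c : ℂ => c • ω := by
  obtain ⟨hωp, hωl⟩ := hω
  set ρ := H.mapInv ω with hρ
  have hρp : IsProbability ρ := H.isProbability_mapInv hωp
  have hρr : ∀ x, H.conv ρ (delta x) = ρ := H.mapInv_conv_delta_of_left_invariant hωl
  -- Both sides are `ρ * μ`: left invariance of `μ` gives `μ`, right invariance of `ρ` gives the
  -- multiple of `ρ`.
  have huniq : ∀ μ, (∀ x, H.conv (delta x) μ = μ) → μ = pairing μ 1 • ρ := fun μ hμ => by
    rw [← H.conv_eq_smul_of_right_invariant hρr, H.conv_eq_smul_of_left_invariant hμ,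
      hρp.pairing_one, one_smul]
  have hωρ : ω = ρ := by rw [huniq ω hωl, hωp.pairing_one, one_smul]
  ext μ
  constructor
  · intro hμ
    refine ⟨pairing μ 1, ?_⟩
    rw [hωρ]
    refine (huniq μ fun x => ext_pairing fun f => ?_).symm
    have hharm : ∀ x, pairing (H.conv (delta x) σ) (H.rightTranslate μ f) =
        H.rightTranslate μ f x := fun x => by
      rw [← H.pairing_conv_right, H.conv_assoc, show H.conv σ μ = μ from hμ,
        H.rightTranslate_apply]
    have := H.eq_const_of_harmonic hρp hρr hσ hσa hharm x
    rwa [H.rightTranslate_apply, H.rightTranslate_apply, H.delta_e_conv] at this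
  · rintro ⟨c, rfl⟩
    change H.conv σ (c • ω) = c • ω
    rw [map_smul, H.conv_eq_smul_of_left_invariant hωl, hσ.pairing_one, one_smul]
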